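/- Setting. Let $\mathcal X,\Phi$ be standard Borel spaces, $\mathcal Y=\mathcal X\times\Phi$ with the product $\sigma$-algebra, and fix a Polish topology on $\mathcal Y$ whose Borel $\sigma$-algebra is this product $\sigma$-algebra. Let $\nu$ be a probability measure on $\mathcal X$ and $\mathcal I$ a measurable space. Let $(P_\gamma)_{\gamma\in\mathcal I}$ be transition (Markov) kernels on $\mathcal Y$ such that $(y,\gamma)\mapsto P_\gamma(y,\cdot)$ is a transition kernel from $\mathcal Y\times\mathcal I$ to $\mathcal Y$, and let $(\pi_\gamma)_{\gamma\in\mathcal I}$ be probability measures on $\mathcal Y$ such that $\pi_\gamma$ is invariant for $P_\gamma$ and has $\mathcal X$-marginal $\nu$. A function $d:\mathcal Y\times\mathcal Y\to[0,\infty)$ is distance-like if it is symmetric, lower semicontinuous, and $d(y_1,y_2)=0\iff y_1=y_2$. Set $\mathcal W(\mu_1,\mu_2)=\inf_\xi\int d\,\mathrm d\xi$, the infimum being over all couplings $\xi$ of $\mu_1,\mu_2$, and for a transition kernel $Q$ on $\mathcal Y$ set $\tau(Q)=\sup_{y_1\ne y_2}\mathcal W(Q(y_1,\cdot),Q(y_2,\cdot))/d(y_1,y_2)$.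 Let $\beta>0$, $T_m=\sum_{j=1}^m\lceil j^\beta\rceil$ and $T_0=0$. An adaptive increasingly rare (AIR) chain with parameter $\beta$ is a process $(Y_n,\Gamma_n)_{n\ge0}$ on a probability space, with values in $\mathcal Y\times\mathcal I$, such that $(Y_0,\Gamma_0)\equiv(y_0,\gamma_0)$ is deterministic; $\Gamma_n=U_n(Y_0,\dots,Y_n,\Gamma_0,\dots,\Gamma_{n-1})$ for some measurable $U_n$; $\mathbb P[Y_{n+1}\in B\mid Y_0,\dots,Y_n,\Gamma_0,\dots,\Gamma_n]=P_{\Gamma_n}(Y_n,B)$ almost surely for every $n\ge0$ and measurable $B$; and $\Gamma_{i_1}=\Gamma_{i_2}$ whenever $i_1,i_2\in\{T_m,\dots,T_{m+1}-1\}$ for some $m\ge0$. Write $Y_n=(X_n,\phi_n)$ with $X_n\in\mathcal X$. Theorem. Let $d$ be distance-like and assume: 1. there are $M\in[1,\infty)$, $\tau\in[0,1)$ and an integer $k_0\ge1$ such that $\tau(P_\gamma)\le M$ and $\tau(P_\gamma^{k_0})\le\tau$ for all $\gamma\in\mathcal I$; 2. there are a measurable $V:\mathcal Y\to[1,\infty)$,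 $\kappa\in(0,1)$ and $b\in(0,\infty)$ such that $P_\gamma V(y)\le\kappa V(y)+b$ for all $\gamma\in\mathcal I$, $y\in\mathcal Y$; 3. there are $p>2$ and $K\in(0,\infty)$ such that $d(y_1,y_2)\le K\,(V(y_1)^{1/p}+V(y_2)^{1/p})$ for all $y_1,y_2\in\mathcal Y$. Let $f:\mathcal X\to\mathbb R$ be measurable and $\nu$-integrable, and set $h(x,\phi)=f(x)$. Suppose that $|h|\le V^{1/p}$ and that, for some $L\in(0,\infty)$, $|h(y_1)-h(y_2)|\le L\,d(y_1,y_2)$ for all $y_1,y_2\in\mathcal Y$. Then for every $\beta>0$, every $\varepsilon>\max\{0,\tfrac1{1+\beta}+\tfrac1p-\tfrac12\}$ and every AIR chain with parameter $\beta$, $$\lim_{n\to\infty}\frac1{n^{1/2+\varepsilon}}\sum_{j=1}^n\bigl(f(X_j)-\nu(f)\bigr)=0\qquad\text{almost surely.}$$ -/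

import Mathlib

open MeasureTheory ProbabilityTheory Filter Topology
open scoped NNReal ENNReal

noncomputable section

namespace AIRMCMC

/-! ### Distance-like and Wasserstein-like functions -/

section Wasserstein

variable {A : Type*}

/-- A distance-like function: symmetric, vanishing exactly on the diagonal, and lower
semicontinuous for the product topology. -/
structure IsDistanceLike [TopologicalSpace A] (d : A → A → ℝ≥0) : Prop where
  symm : ∀ x y, d x y = d y x
  eq_zero_iff : ∀ x y, d x y = 0 ↔ x = y
  lsc : LowerSemicontinuous fun z : A × A => d z.1 z.2

/-- `ψ` is Lipschitz with constant `L` with respect to `d`. -/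
def IsLipschitzWrt (d : A → A → ℝ≥0) (L : ℝ) (ψ : A → ℝ) : Prop :=
  ∀ x y, |ψ x - ψ y| ≤ L * d x y

variable [MeasurableSpace A]

/-- The couplings of `μ₁` and `μ₂`: the measures on `A × A` with these marginals. -/
def couplings (μ₁ μ₂ : Measure A) : Set (Measure (A × A)) :=
  {ξ | ξ.fst = μ₁ ∧ ξ.snd = μ₂}

/-- The Wasserstein-like function associated with `d`. -/
def wasserstein (d : A → A → ℝ≥0) (μ₁ μ₂ : Measure A) : ℝ≥0∞ :=
  ⨅ ξ ∈ couplings μ₁ μ₂, ∫⁻ z, (d z.1 z.2 : ℝ≥0∞) ∂ξ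

/-- The Wasserstein contraction coefficient of a transition kernel. -/
def contractionCoeff (d : A → A → ℝ≥0) (Q : Kernel A A) : ℝ≥0∞ :=
  ⨆ (y₁ : A) (y₂ : A) (_ : y₁ ≠ y₂), wasserstein d (Q y₁) (Q y₂) / (d y₁ y₂ : ℝ≥0∞)

end Wasserstein

/-! ### Families of kernels

A family of transition kernels `(P_γ)` on `Y`, jointly measurable in `(y, γ)`, is a kernel `P` from
`Y × I` to `Y`; the kernel `P_γ` is `P.sectL γ`, and `P_γ(y, ·) = P (y, γ)`. -/

section Family

variable {Y I : Type*} [MeasurableSpace Y] [MeasurableSpace I]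

/-- Every `π γ` is an invariant distribution of `P_γ`. -/
structure IsInvariantFamily (P : Kernel (Y × I) Y) (π : I → Measure Y) : Prop where
  prob : ∀ γ, IsProbabilityMeasure (π γ)
  invariant : ∀ γ, (P.sectL γ).Invariant (π γ)

/-- The uniform Wasserstein contraction assumption: `τ(P_γ) ≤ M` and `τ(P_γ ^ k₀) ≤ τ < 1`
with `M`, `τ`, `k₀` independent of `γ`. -/
def UniformContraction (d : Y → Y → ℝ≥0) (P : Kernel (Y × I) Y) : Prop :=
  ∃ M τ : ℝ, ∃ k₀ : ℕ, 1 ≤ M ∧ 0 ≤ τ ∧ τ < 1 ∧ 1 ≤ k₀ ∧ ∀ γ : I,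
    contractionCoeff d (P.sectL γ) ≤ ENNReal.ofReal M ∧
    contractionCoeff d (P.sectL γ ^ k₀) ≤ ENNReal.ofReal τ

/-- `V : Y → [1, ∞)` is a Lyapunov function for all the `P_γ` with common constants. -/
structure IsCommonLyapunov (P : Kernel (Y × I) Y) (V : Y → ℝ) : Prop where
  measurable : Measurable V
  one_le : ∀ y, 1 ≤ V y
  drift : ∃ κ b : ℝ, 0 < κ ∧ κ < 1 ∧ 0 < b ∧ ∀ (γ : I) (y : Y),
    ∫⁻ y', ENNReal.ofReal (V y') ∂(P (y, γ)) ≤ ENNReal.ofReal (κ * V y + b)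

end Family

/-! ### Adaptive and adaptive increasingly rare chains -/

section Chain

variable {Ω Y I : Type*} [MeasurableSpace Ω] [MeasurableSpace Y] [MeasurableSpace I]

/-- The σ-algebra generated by `Y_0, …, Y_n, Γ_0, …, Γ_n`. -/
@[reducible] def history (Yc : ℕ → Ω → Y) (Γ : ℕ → Ω → I) (n : ℕ) : MeasurableSpace Ω :=
  ⨆ j ≤ n, (MeasurableSpace.comap (Yc j) inferInstance ⊔
    MeasurableSpace.comap (Γ j) inferInstance)

/-- `(Y_n, Γ_n)` is an adaptive chain driven by the kernels `P_γ`, started at `(y₀, γ₀)`: given the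
history up to time `n`, the law of `Y_{n+1}` is `P_{Γ_n}(Y_n, ·)`, and `Γ_n` is a measurable
function of `Y_0, …, Y_n, Γ_0, …, Γ_{n-1}`. -/
structure IsAdaptiveChain (μ : Measure Ω) (P : Kernel (Y × I) Y) (y₀ : Y) (γ₀ : I)
    (Yc : ℕ → Ω → Y) (Γ : ℕ → Ω → I) : Prop where
  measurable_state : ∀ n, Measurable (Yc n)
  measurable_param : ∀ n, Measurable (Γ n)
  init_state : ∀ ω, Yc 0 ω = y₀
  init_param : ∀ ω, Γ 0 ω = γ₀
  transition : ∀ (n : ℕ) (B : Set Y), MeasurableSet B →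
    μ⟦Yc (n + 1) ⁻¹' B | history Yc Γ n⟧ =ᵐ[μ] fun ω => (P (Yc n ω, Γ n ω)).real B
  update : ∀ n : ℕ, ∃ U : (Fin (n + 1) → Y) × (Fin n → I) → I, Measurable U ∧
    ∀ ω, Γ n ω = U (fun i => Yc i ω, fun i => Γ i ω)

/-- The adaptation times `T_m = ∑_{j=1}^m ⌈j ^ β⌉`, with `T_0 = 0`. -/
def adaptTime (β : ℝ) (m : ℕ) : ℕ :=
  ∑ j ∈ Finset.Icc 1 m, ⌈(j : ℝ) ^ β⌉₊

/-- Adaptation only takes place at the times `T_m`: the parameter is constant on every block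
`{T_m, …, T_{m+1} - 1}`. -/
def IsIncreasinglyRare (β : ℝ) (Γ : ℕ → Ω → I) : Prop :=
  ∀ m i₁ i₂ : ℕ, i₁ ∈ Set.Ico (adaptTime β m) (adaptTime β (m + 1)) →
    i₂ ∈ Set.Ico (adaptTime β m) (adaptTime β (m + 1)) → ∀ ω, Γ i₁ ω = Γ i₂ ω

end Chain

end AIRMCMC

end

/-! The proof combines Poisson equations with a count of the adaptation times. Write h(x, φ) = f(x).
Since all π_γ have the same 𝒳-marginal, h has the same mean ν(f) under each of them. Contraction
makes the centred iterates P_γ^k h - ν(f) decay geometrically relative to V^(1/p), uniformly in γ.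
Their sum g_γ therefore solves g_γ - P_γ g_γ = h - ν(f) with |g_γ| ≤ C V^(1/p)
(`exists_poisson_solution`).

Along the chain, h(Y_j) - ν(f) is then the martingale difference g_{Γ_j}(Y_{j+1}) - P_{Γ_j}
g_{Γ_j}(Y_j) plus the increment g_{Γ_j}(Y_j) - g_{Γ_j}(Y_{j+1}). The differences are bounded in L²
because V has bounded means along the chain and p ≥ 2, so L² martingale convergence and Kronecker's
lemma make their sum o(n^a) for every a > 1/2 (`tendsto_sum_poisson_martingale`).

The increments telescope except where Γ changes. This happens O(n^(1/(1+β))) times up to time n, and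
each jump is almost surely O(n^q) for any q > 1/p (`ae_exists_le_mul_rpow`), so this part is also
negligible (`tendsto_sum_sub_div`). -/

noncomputable section

namespace AIRMCMC

/-! ### Contraction, drift and invariance for one kernel -/

section SingleKernel

variable {A : Type*} [MeasurableSpace A]

/-- Weak Kantorovich duality: integrals of a `d`-Lipschitz function differ by at most its constant
times the Wasserstein distance. -/
theorem ofReal_abs_integral_sub_le {d : A → A → ℝ≥0} {L : ℝ} (hL : 0 < L) {ψ : A → ℝ}
    (hψ : IsLipschitzWrt d L ψ) {μ₁ μ₂ : Measure A} (h₁ : Integrable ψ μ₁)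
    (h₂ : Integrable ψ μ₂) :
    ENNReal.ofReal |∫ x, ψ x ∂μ₁ - ∫ x, ψ x ∂μ₂| ≤ ENNReal.ofReal L * wasserstein d μ₁ μ₂ := by
  have hL0 : ENNReal.ofReal L ≠ 0 := by simpa using hL
  unfold wasserstein
  -- A finite nonzero factor passes through the infimum, so it suffices to treat a single coupling.
  simp_rw [ENNReal.mul_iInf_of_ne hL0 ENNReal.ofReal_ne_top]
  refine le_iInf₂ fun ξ hξ => ?_
  obtain ⟨rfl, rfl⟩ := hξ
  have e₁ : ∫ x, ψ x ∂ξ.fst = ∫ z, ψ z.1 ∂ξ :=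
    integral_map measurable_fst.aemeasurable h₁.aestronglyMeasurable
  have e₂ : ∫ x, ψ x ∂ξ.snd = ∫ z, ψ z.2 ∂ξ :=
    integral_map measurable_snd.aemeasurable h₂.aestronglyMeasurable
  have i₁ : Integrable (fun z : A × A => ψ z.1) ξ := h₁.comp_measurable measurable_fst
  have i₂ : Integrable (fun z : A × A => ψ z.2) ξ := h₂.comp_measurable measurable_snd
  rw [e₁, e₂, ← integral_sub i₁ i₂, ← Real.enorm_eq_ofReal_abs]
  refine (enorm_integral_le_lintegral_enorm _).trans ?_
  rw [← lintegral_const_mul' _ _ ENNReal.ofReal_ne_top]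
  refine lintegral_mono fun z => ?_
  rw [Real.enorm_eq_ofReal_abs, ← ENNReal.ofReal_coe_nnreal, ← ENNReal.ofReal_mul hL.le]
  exact ENNReal.ofReal_le_ofReal (hψ z.1 z.2)

/-- Weak duality bounds the difference by L times the Wasserstein distance of Q x and Q y, which is
at most M d(x, y). The diagonal is separate because the contraction coefficient only ranges over
distinct points. -/
theorem IsLipschitzWrt.integral_kernel [TopologicalSpace A] {d : A → A → ℝ≥0}
    (hd : IsDistanceLike d) {L M : ℝ} (hL : 0 < L) (hM : 0 ≤ M) {Q : Kernel A A}
    (hQ : contractionCoeff d Q ≤ ENNReal.ofReal M) {ψ : A → ℝ} (hψ : IsLipschitzWrt d L ψ)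
    (hi : ∀ y, Integrable ψ (Q y)) :
    IsLipschitzWrt d (L * M) (fun y => ∫ z, ψ z ∂(Q y)) := by
  intro x y
  rcases eq_or_ne x y with rfl | hxy
  · simp only [sub_self, abs_zero]
    positivity
  have h0 : (d x y : ℝ≥0∞) ≠ 0 := by
    simpa using fun h => hxy ((hd.eq_zero_iff x y).1 h)
  have hW : wasserstein d (Q x) (Q y) ≤ ENNReal.ofReal M * d x y := by
    rw [← ENNReal.div_le_iff h0 ENNReal.coe_ne_top]
    refine le_trans ?_ hQ
    unfold contractionCoeff
    exact le_iSup_of_le x (le_iSup_of_le y (le_iSup_of_le hxy le_rfl))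
  have h := (ofReal_abs_integral_sub_le hL hψ (hi x) (hi y)).trans
    (mul_le_mul_right hW (ENNReal.ofReal L))
  rw [← ENNReal.ofReal_coe_nnreal, ← ENNReal.ofReal_mul hM, ← ENNReal.ofReal_mul hL.le,
    ENNReal.ofReal_le_ofReal_iff (by positivity)] at h
  simpa [mul_assoc] using h

theorem integral_pow_add (Q : Kernel A A) (m n : ℕ) (y : A) {ψ : A → ℝ}
    (h : Integrable ψ ((Q ^ (m + n)) y)) :
    ∫ z, ψ z ∂((Q ^ (m + n)) y) = ∫ x, ∫ z, ψ z ∂((Q ^ m) x) ∂((Q ^ n) y) := by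
  rw [Kernel.pow_add] at h ⊢
  exact Kernel.integral_comp h

theorem integrable_integral_pow (Q : Kernel A A) (m n : ℕ) (y : A) {ψ : A → ℝ}
    (h : Integrable ψ ((Q ^ (m + n)) y)) :
    Integrable (fun x => ∫ z, ψ z ∂((Q ^ m) x)) ((Q ^ n) y) := by
  rw [Kernel.pow_add] at h
  exact h.integral_comp

/-- Split k = r + k₀ n with r < k₀: each of the r single steps costs a factor M, and each block of
k₀ steps gains a factor τ. Positivity of M and τ keeps every intermediate Lipschitz constant
positive, as duality requires. -/
theorem IsLipschitzWrt.integral_pow [TopologicalSpace A] {d : A → A → ℝ≥0}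
    (hd : IsDistanceLike d) {L M τ : ℝ} {k₀ : ℕ} (hL : 0 < L) (hM : 0 < M) (hτ : 0 < τ)
    {Q : Kernel A A} (hQ : contractionCoeff d Q ≤ ENNReal.ofReal M)
    (hQk : contractionCoeff d (Q ^ k₀) ≤ ENNReal.ofReal τ) {ψ : A → ℝ}
    (hψm : Measurable ψ) (hψ : IsLipschitzWrt d L ψ) (hi : ∀ k y, Integrable ψ ((Q ^ k) y))
    (k : ℕ) :
    IsLipschitzWrt d (L * M ^ (k % k₀) * τ ^ (k / k₀)) (fun y => ∫ z, ψ z ∂((Q ^ k) y)) := by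
  have small : ∀ r : ℕ, IsLipschitzWrt d (L * M ^ r) (fun y => ∫ z, ψ z ∂((Q ^ r) y)) := by
    intro r
    induction r with
    | zero =>
      have e : (fun y => ∫ z, ψ z ∂((Q ^ 0) y)) = ψ := funext fun y => by
        rw [pow_zero]
        exact integral_dirac' _ _ hψm.stronglyMeasurable
      rw [e, pow_zero, mul_one]
      exact hψ
    | succ r ih =>
      have h := ih.integral_kernel hd (by positivity) hM.le hQ
        (fun y => by simpa using integrable_integral_pow Q r 1 y (hi _ y))
      have e : (fun y => ∫ z, ψ z ∂((Q ^ (r + 1)) y)) =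
          fun y => ∫ x, ∫ z, ψ z ∂((Q ^ r) x) ∂(Q y) := funext fun y => by
        rw [integral_pow_add Q r 1 y (hi _ y), pow_one]
      rw [e, pow_succ, ← mul_assoc]
      exact h
  have large : ∀ n r : ℕ, IsLipschitzWrt d (L * M ^ r * τ ^ n)
      (fun y => ∫ z, ψ z ∂((Q ^ (r + k₀ * n)) y)) := by
    intro n r
    induction n with
    | zero => simpa using small r
    | succ n ih =>
      have h := ih.integral_kernel hd (by positivity) hτ.le hQk
        (fun y => integrable_integral_pow Q (r + k₀ * n) k₀ y (hi _ y))
      have e : (fun y => ∫ z, ψ z ∂((Q ^ (r + k₀ * (n + 1))) y)) =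
          fun y => ∫ x, ∫ z, ψ z ∂((Q ^ (r + k₀ * n)) x) ∂((Q ^ k₀) y) := funext fun y => by
        rw [mul_add, mul_one, ← add_assoc]
        exact integral_pow_add Q _ k₀ y (hi _ y)
      rw [e, pow_succ, ← mul_assoc]
      exact h
  have := large (k / k₀) (k % k₀)
  rwa [Nat.mod_add_div] at this

theorem isMarkovKernel_pow (Q : Kernel A A) [IsMarkovKernel Q] (k : ℕ) :
    IsMarkovKernel (Q ^ k) := by
  induction k with
  | zero =>
    have e : Q ^ 0 = Kernel.id := pow_zero Q
    rw [e]
    infer_instance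
  | succ k ih =>
    rw [Kernel.pow_add, pow_one]
    infer_instance

/-- The drift is iterated; b / (1 - κ) is the fixed point of x ↦ κ x + b. -/
theorem lintegral_pow_le {Q : Kernel A A} {V : A → ℝ} (hV : Measurable V) (hV1 : ∀ y, 1 ≤ V y)
    {κ b : ℝ} (hκ : 0 < κ) (hκ1 : κ < 1) (hb : 0 < b)
    [IsMarkovKernel Q]
    (hdrift : ∀ y, ∫⁻ z, ENNReal.ofReal (V z) ∂(Q y) ≤ ENNReal.ofReal (κ * V y + b))
    (k : ℕ) (y : A) :
    ∫⁻ z, ENNReal.ofReal (V z) ∂((Q ^ k) y) ≤ ENNReal.ofReal (κ ^ k * V y + b / (1 - κ)) := by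
  have hB : 0 < b / (1 - κ) := div_pos hb (by linarith)
  have hm := hV.ennreal_ofReal
  induction k generalizing y with
  | zero =>
    have e : (Q ^ 0) y = Measure.dirac y := by rw [pow_zero]; exact Kernel.id_apply y
    rw [e, lintegral_dirac' _ hm]
    exact ENNReal.ofReal_le_ofReal (by linarith)
  | succ k ih =>
    have hV0 : 0 ≤ V y := by linarith [hV1 y]
    have hprob := isMarkovKernel_pow Q k
    rw [add_comm k 1, Kernel.pow_add, Kernel.lintegral_comp _ _ _ hm, pow_one]
    calc ∫⁻ x, ∫⁻ z, ENNReal.ofReal (V z) ∂(Q x) ∂((Q ^ k) y)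
        ≤ ∫⁻ x, (ENNReal.ofReal κ * ENNReal.ofReal (V x) + ENNReal.ofReal b) ∂((Q ^ k) y) := by
          refine lintegral_mono fun x => (hdrift x).trans ?_
          rw [← ENNReal.ofReal_mul hκ.le]
          exact ENNReal.ofReal_add_le
      _ = ENNReal.ofReal κ * ∫⁻ x, ENNReal.ofReal (V x) ∂((Q ^ k) y) + ENNReal.ofReal b := by
          rw [lintegral_add_right _ measurable_const, lintegral_const_mul _ hm]
          simp
      _ ≤ ENNReal.ofReal κ * ENNReal.ofReal (κ ^ k * V y + b / (1 - κ)) + ENNReal.ofReal b := by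
          gcongr
          exact ih y
      _ = ENNReal.ofReal (κ ^ (1 + k) * V y + b / (1 - κ)) := by
          rw [← ENNReal.ofReal_mul hκ.le, ← ENNReal.ofReal_add (by positivity) hb.le]
          congr 1
          have : 1 - κ ≠ 0 := by linarith
          field_simp
          ring

theorem invariant_pow {Q : Kernel A A} {ρ : Measure A} (h : Q.Invariant ρ) (k : ℕ) :
    (Q ^ k).Invariant ρ := by
  induction k with
  | zero => rw [pow_zero]; exact Measure.bind_dirac
  | succ k ih => rw [pow_succ]; exact ih.comp h

/-- The integral of V under ρ might be infinite, so the drift bound cannot be integrated directly.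
Truncating V at N, using invariance under Q ^ k and letting k → ∞ by dominated convergence removes
the starting point; then N → ∞ by monotone convergence. -/
theorem lintegral_invariant_le {Q : Kernel A A} [IsMarkovKernel Q] {ρ : Measure A}
    [IsProbabilityMeasure ρ] (hρ : Q.Invariant ρ) {V : A → ℝ} (hV : Measurable V)
    {κ B : ℝ} (hκ : 0 < κ) (hκ1 : κ < 1)
    (hpow : ∀ k y, ∫⁻ z, ENNReal.ofReal (V z) ∂((Q ^ k) y) ≤ ENNReal.ofReal (κ ^ k * V y + B)) :
    ∫⁻ z, ENNReal.ofReal (V z) ∂ρ ≤ ENNReal.ofReal B := by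
  have hm := hV.ennreal_ofReal
  have trunc : ∀ N : ℕ, ∫⁻ z, min (ENNReal.ofReal (V z)) N ∂ρ ≤ ENNReal.ofReal B := by
    intro N
    have hmN : Measurable fun z => min (ENNReal.ofReal (V z)) (N : ℝ≥0∞) :=
      hm.min measurable_const
    have step : ∀ k : ℕ, ∫⁻ z, min (ENNReal.ofReal (V z)) N ∂ρ ≤
        ∫⁻ y, min (ENNReal.ofReal (κ ^ k * V y + B)) N ∂ρ := by
      intro k
      have hk := isMarkovKernel_pow Q k
      conv_lhs => rw [← (invariant_pow hρ k).def]
      rw [Measure.lintegral_bind (Kernel.aemeasurable _) hmN.aemeasurable]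
      refine lintegral_mono fun y => le_min ?_ ?_
      · exact (lintegral_mono fun z => min_le_left _ _).trans (hpow k y)
      · exact (lintegral_mono fun z => min_le_right _ _).trans (by simp)
    have lim : Tendsto (fun k : ℕ => ∫⁻ y, min (ENNReal.ofReal (κ ^ k * V y + B)) N ∂ρ) atTop
        (𝓝 (∫⁻ _, min (ENNReal.ofReal B) N ∂ρ)) := by
      refine tendsto_lintegral_of_dominated_convergence (fun _ => (N : ℝ≥0∞))
        (fun k => ?_) (fun k => Eventually.of_forall fun y => min_le_right _ _) (by simp)
        (Eventually.of_forall fun y => ?_)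
      · exact (((hV.const_mul _).add_const _).ennreal_ofReal).min measurable_const
      · refine Tendsto.min (ENNReal.tendsto_ofReal ?_) tendsto_const_nhds
        simpa using ((tendsto_pow_atTop_nhds_zero_of_lt_one hκ.le hκ1).mul_const (V y)).add_const B
    refine (ge_of_tendsto' lim step).trans ?_
    simp
  have hsup : ∀ z, ENNReal.ofReal (V z) = ⨆ N : ℕ, min (ENNReal.ofReal (V z)) N := by
    intro z
    refine le_antisymm ?_ (iSup_le fun N => min_le_left _ _)
    obtain ⟨N, hN⟩ := ENNReal.exists_nat_gt (ENNReal.ofReal_ne_top (r := V z))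
    exact le_iSup_of_le N (le_min le_rfl hN.le)
  have hmono : Monotone fun (N : ℕ) (z : A) => min (ENNReal.ofReal (V z)) (N : ℝ≥0∞) :=
    fun M N h z => min_le_min le_rfl (Nat.cast_le.2 h)
  rw [lintegral_congr hsup, lintegral_iSup (fun N => hm.min measurable_const) hmono]
  exact iSup_le trunc

/-- Invariance is read as a composition with the constant kernel ρ; the point y only serves to
evaluate that kernel. -/
theorem integral_invariant {Q : Kernel A A} {ρ : Measure A} (hρ : Q.Invariant ρ) (y : A)
    {ψ : A → ℝ} (hi : Integrable ψ ρ) :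
    Integrable (fun x => ∫ z, ψ z ∂(Q x)) ρ ∧ ∫ x, ∫ z, ψ z ∂(Q x) ∂ρ = ∫ z, ψ z ∂ρ := by
  have e : (Q ∘ₖ Kernel.const A ρ) y = ρ := by rw [hρ.comp_const, Kernel.const_apply]
  have hi' : Integrable ψ ((Q ∘ₖ Kernel.const A ρ) y) := by rwa [e]
  have h₁ := hi'.integral_comp
  have h₂ := Kernel.integral_comp hi'
  rw [e] at h₂
  rw [Kernel.const_apply] at h₁ h₂
  exact ⟨h₁, h₂.symm⟩

/-- A `d`-Lipschitz function is close to its mean when `d` is dominated by an integrable weight. -/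
theorem abs_sub_integral_le {d : A → A → ℝ≥0} {c K B : ℝ} (hc : 0 ≤ c) (hK : 0 ≤ K)
    {U W : A → ℝ} (hU : IsLipschitzWrt d c U) {ρ : Measure A} [IsProbabilityMeasure ρ]
    (hUi : Integrable U ρ) (hWi : Integrable W ρ) (hW : ∀ y, 1 ≤ W y) (hWB : ∫ y, W y ∂ρ ≤ B)
    (hdW : ∀ y z, (d y z : ℝ) ≤ K * (W y + W z)) (y : A) :
    |U y - ∫ z, U z ∂ρ| ≤ c * (K * (1 + B)) * W y := by
  have e : U y - ∫ z, U z ∂ρ = ∫ z, (U y - U z) ∂ρ := by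
    rw [integral_sub (integrable_const _) hUi]
    simp
  have hB : 0 ≤ B := (integral_nonneg fun z => zero_le_one.trans (hW z)).trans hWB
  rw [e]
  calc |∫ z, (U y - U z) ∂ρ| ≤ ∫ z, |U y - U z| ∂ρ := abs_integral_le_integral_abs
    _ ≤ ∫ z, (c * K) * (W y + W z) ∂ρ := by
        refine integral_mono ((integrable_const _).sub hUi).abs
          (((integrable_const _).add hWi).const_mul _) fun z => ?_
        rw [mul_assoc]
        exact (hU y z).trans (mul_le_mul_of_nonneg_left (hdW y z) hc)
    _ = c * K * (W y + ∫ z, W z ∂ρ) := by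
        rw [integral_const_mul, integral_add (integrable_const _) hWi]
        simp
    _ ≤ c * K * (W y + B * W y) := by
        gcongr
        exact hWB.trans (le_mul_of_one_le_right hB (hW y))
    _ = c * (K * (1 + B)) * W y := by ring

/-- Integrating against Q shifts the series by one index, so only the zeroth term is lost. The
weight W dominates the terms and justifies exchanging sum and integral. -/
theorem integral_tsum_eq_sub {Q : Kernel A A} {u : ℕ → A → ℝ} {c : ℕ → ℝ} {W : A → ℝ}
    (hu : ∀ k, Measurable (u k)) (hc : Summable c) (huW : ∀ k y, |u k y| ≤ c k * W y) (y : A)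
    (hW : Integrable W (Q y)) (hrec : ∀ k, u (k + 1) y = ∫ z, u k z ∂(Q y)) :
    ∫ z, ∑' k, u k z ∂(Q y) = (∑' k, u k y) - u 0 y := by
  have hi : ∀ k, Integrable (u k) (Q y) := fun k =>
    (hW.const_mul (c k)).mono' (hu k).aestronglyMeasurable
      (Eventually.of_forall fun z => huW k z)
  have hs : Summable fun k => ∫ z, ‖u k z‖ ∂(Q y) := by
    refine Summable.of_nonneg_of_le (fun k => integral_nonneg fun z => norm_nonneg _)
      (fun k => ?_) (hc.mul_right (∫ z, W z ∂(Q y)))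
    rw [← integral_const_mul]
    exact integral_mono (hi k).norm (hW.const_mul _) fun z => huW k z
  have hsum : Summable fun k => u k y :=
    Summable.of_norm_bounded (hc.mul_right (W y)) fun k => huW k y
  rw [← (hasSum_integral_of_summable_integral_norm hi hs).tsum_eq, hsum.tsum_eq_zero_add]
  simp [hrec]

/-- Under k ↔ (k / k₀, k % k₀) this is a geometric series times a finite sum. -/
theorem summable_pow_mod_mul_pow_div {M τ : ℝ} {k₀ : ℕ} (hk₀ : 1 ≤ k₀) (hM : 0 ≤ M) (hτ : 0 ≤ τ)
    (hτ1 : τ < 1) (L : ℝ) : Summable fun k : ℕ => L * M ^ (k % k₀) * τ ^ (k / k₀) := by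
  have : NeZero k₀ := ⟨by omega⟩
  obtain ⟨f, hf⟩ : ∃ f : ℕ → ℝ, ∀ n, f n = τ ^ n := ⟨_, fun _ => rfl⟩
  obtain ⟨g, hg⟩ : ∃ g : Fin k₀ → ℝ, ∀ r, g r = M ^ (r : ℕ) := ⟨_, fun _ => rfl⟩
  have hfs : Summable f := (summable_geometric_of_lt_one hτ hτ1).congr fun n => (hf n).symm
  have hf0 : 0 ≤ f := fun n => (hf n).symm ▸ pow_nonneg hτ n
  have hg0 : 0 ≤ g := fun r => (hg r).symm ▸ pow_nonneg hM _
  have h := (hfs.mul_of_nonneg (hasSum_fintype g).summable hf0 hg0).comp_injective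
    (Nat.divModEquiv k₀).injective
  refine (h.mul_left L).congr fun k => ?_
  simp only [Function.comp_apply, hf, hg, Nat.divModEquiv, Equiv.coe_fn_mk, Fin.val_ofNat]
  ring

end SingleKernel

/-! ### Uniform solutions of the Poisson equations -/

section Poisson

theorem integrable_of_abs_le_of_lintegral_le {A : Type*} [MeasurableSpace A] {ρ : Measure A}
    {V ψ : A → ℝ} {c : ℝ} (hψ : Measurable ψ) (hψV : ∀ y, |ψ y| ≤ V y)
    (h : ∫⁻ y, ENNReal.ofReal (V y) ∂ρ ≤ ENNReal.ofReal c) : Integrable ψ ρ := by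
  refine ⟨hψ.aestronglyMeasurable, ?_⟩
  rw [hasFiniteIntegral_iff_norm]
  exact (lintegral_mono fun y => ENNReal.ofReal_le_ofReal (hψV y)).trans_lt
    (h.trans_lt ENNReal.ofReal_lt_top)

variable {A I : Type*} [MeasurableSpace A] [MeasurableSpace I]

/-- The powers are taken with γ frozen, so joint measurability is not automatic. It propagates by
peeling off the first step, an integral against the jointly measurable P. -/
theorem measurable_integral_sectL_pow {P : Kernel (A × I) A} [IsMarkovKernel P] {ψ : A → ℝ}
    (hψ : Measurable ψ) (hi : ∀ γ k y, Integrable ψ ((P.sectL γ ^ k) y)) (k : ℕ) :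
    Measurable fun z : A × I => ∫ x, ψ x ∂((P.sectL z.2 ^ k) z.1) := by
  induction k with
  | zero =>
    have e : (fun z : A × I => ∫ x, ψ x ∂((P.sectL z.2 ^ 0) z.1)) = fun z => ψ z.1 := by
      funext z
      rw [pow_zero]
      exact integral_dirac' _ _ hψ.stronglyMeasurable
    rw [e]
    exact hψ.comp measurable_fst
  | succ k ih =>
    have e : (fun z : A × I => ∫ x, ψ x ∂((P.sectL z.2 ^ (k + 1)) z.1)) =
        fun z => ∫ x, (fun w : (A × I) × A => ∫ x', ψ x' ∂((P.sectL w.1.2 ^ k) w.2)) (z, x)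
          ∂(P z) := by
      funext z
      rw [integral_pow_add _ k 1 _ (hi _ _ _), pow_one, Kernel.sectL_apply]
    rw [e]
    have hm : Measurable fun w : (A × I) × A => ∫ x', ψ x' ∂((P.sectL w.1.2 ^ k) w.2) :=
      ih.comp (measurable_snd.prodMk (measurable_snd.comp measurable_fst))
    exact hm.stronglyMeasurable.integral_kernel_prod_right'.measurable

/-- The Poisson equations for the kernels `P_γ` have jointly measurable solutions, bounded
uniformly in `γ` by a multiple of `V ^ (1 / p)`. -/
theorem exists_poisson_solution [TopologicalSpace A] {P : Kernel (A × I) A} [IsMarkovKernel P]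
    {π : I → Measure A} (hπ : IsInvariantFamily P π) {d : A → A → ℝ≥0} (hd : IsDistanceLike d)
    (hcontr : UniformContraction d P) {V : A → ℝ} (hV : IsCommonLyapunov P V) {p : ℝ}
    (hp : 1 ≤ p) {K : ℝ} (hK : 0 < K)
    (hdV : ∀ y₁ y₂, (d y₁ y₂ : ℝ) ≤ K * (V y₁ ^ (1 / p) + V y₂ ^ (1 / p)))
    {ψ : A → ℝ} (hψ : Measurable ψ) {L : ℝ} (hL : 0 < L) (hLip : IsLipschitzWrt d L ψ)
    (hψV : ∀ y, |ψ y| ≤ V y ^ (1 / p)) {m : ℝ} (hm : ∀ γ, ∫ y, ψ y ∂(π γ) = m) :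
    ∃ (g : A × I → ℝ) (C : ℝ), Measurable g ∧ 0 ≤ C ∧ (∀ z, |g z| ≤ C * V z.1 ^ (1 / p)) ∧
      ∀ y γ, ∫ x, g (x, γ) ∂(P (y, γ)) = g (y, γ) - (ψ y - m) := by
  obtain ⟨M, τ₀, k₀, hM, hτ₀, hτ₀1, hk₀, hcoef⟩ := hcontr
  obtain ⟨κ, b, hκ, hκ1, hb, hdrift⟩ := hV.drift
  -- The given rate may be 0; a larger one below 1 is strictly positive.
  obtain ⟨τ, hτ₀τ, hτ1⟩ := exists_between hτ₀1
  have hτ : 0 < τ := hτ₀.trans_lt hτ₀τ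
  set B := b / (1 - κ) with hBdef
  have hW1 : ∀ y, 1 ≤ V y ^ (1 / p) := fun y => Real.one_le_rpow (hV.one_le y) (by positivity)
  have hWV : ∀ y, V y ^ (1 / p) ≤ V y := fun y => by
    conv_rhs => rw [← Real.rpow_one (V y)]
    exact Real.rpow_le_rpow_of_exponent_le (hV.one_le y)
      (by rw [div_le_one (by positivity)]; exact hp)
  have hWm : Measurable fun y => V y ^ (1 / p) := hV.measurable.pow_const _
  have hWabs : ∀ y, |V y ^ (1 / p)| ≤ V y := fun y => by
    rw [abs_of_nonneg (zero_le_one.trans (hW1 y))]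
    exact hWV y
  have hpow : ∀ γ k y, ∫⁻ z, ENNReal.ofReal (V z) ∂((P.sectL γ ^ k) y) ≤
      ENNReal.ofReal (κ ^ k * V y + B) := fun γ k y =>
    lintegral_pow_le hV.measurable hV.one_le hκ hκ1 hb (fun y => hdrift γ y) k y
  have hi : ∀ γ k y, Integrable ψ ((P.sectL γ ^ k) y) := fun γ k y =>
    integrable_of_abs_le_of_lintegral_le hψ (fun y => (hψV y).trans (hWV y)) (hpow γ k y)
  have hWi : ∀ γ y, Integrable (fun y => V y ^ (1 / p)) (P (y, γ)) := fun γ y =>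
    integrable_of_abs_le_of_lintegral_le hWm hWabs (hdrift γ y)
  have hπV : ∀ γ, ∫⁻ z, ENNReal.ofReal (V z) ∂(π γ) ≤ ENNReal.ofReal B := fun γ =>
    have := hπ.prob γ
    lintegral_invariant_le (hπ.invariant γ) hV.measurable hκ hκ1 (hpow γ)
  have hB : 0 < B := div_pos hb (by linarith)
  have hψπ : ∀ γ, Integrable ψ (π γ) := fun γ =>
    integrable_of_abs_le_of_lintegral_le hψ (fun y => (hψV y).trans (hWV y)) (hπV γ)
  have hWπ : ∀ γ, Integrable (fun y => V y ^ (1 / p)) (π γ) := fun γ =>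
    integrable_of_abs_le_of_lintegral_le hWm hWabs (hπV γ)
  have hWB : ∀ γ, ∫ y, V y ^ (1 / p) ∂(π γ) ≤ B := fun γ => by
    rw [← ENNReal.ofReal_le_ofReal_iff hB.le,
      ofReal_integral_eq_lintegral_ofReal (hWπ γ)
        (Eventually.of_forall fun y => zero_le_one.trans (hW1 y))]
    exact (lintegral_mono fun y => ENNReal.ofReal_le_ofReal (hWV y)).trans (hπV γ)
  let c : ℕ → ℝ := fun k => L * M ^ (k % k₀) * τ ^ (k / k₀)
  have hM0 : 0 < M := zero_lt_one.trans_le hM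
  have hc0 : ∀ k, 0 ≤ c k := fun k => by positivity
  have hcs : Summable fun k => c k * (K * (1 + B)) :=
    (summable_pow_mod_mul_pow_div hk₀ hM0.le hτ.le hτ1 L).mul_right _
  -- The centred iterates, whose sum over k is the solution.
  let u : ℕ → A × I → ℝ := fun k z => (∫ x, ψ x ∂((P.sectL z.2 ^ k) z.1)) - m
  have hum : ∀ k, Measurable (u k) := fun k =>
    (measurable_integral_sectL_pow hψ hi k).sub_const _
  have hub : ∀ k z, |u k z| ≤ c k * (K * (1 + B)) * V z.1 ^ (1 / p) := by
    rintro k ⟨y, γ⟩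
    have := hπ.prob γ
    have hU := hLip.integral_pow hd hL hM0 hτ (hcoef γ).1
      ((hcoef γ).2.trans (ENNReal.ofReal_le_ofReal hτ₀τ.le)) hψ (hi γ) k
    have hinv := integral_invariant (invariant_pow (hπ.invariant γ) k) y (hψπ γ)
    have h := abs_sub_integral_le (hc0 k) hK.le hU hinv.1 (hWπ γ) hW1 (hWB γ) hdV y
    rw [hinv.2, hm γ] at h
    exact h
  refine ⟨fun z => ∑' k, u k z, ∑' k, c k * (K * (1 + B)), ?_, ?_, ?_, ?_⟩
  · refine measurable_of_tendsto_metrizable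
      (f := fun n z => ∑ k ∈ Finset.range n, u k z)
      (fun n => Finset.measurable_fun_sum _ fun k _ => hum k) ?_
    rw [tendsto_pi_nhds]
    intro z
    exact (Summable.of_norm_bounded (hcs.mul_right (V z.1 ^ (1 / p)))
      fun k => hub k z).hasSum.tendsto_sum_nat
  · exact tsum_nonneg fun k => mul_nonneg (hc0 k) (by positivity)
  · intro z
    rw [← tsum_mul_right]
    exact tsum_of_norm_bounded (f := fun k => u k z) (hcs.mul_right (V z.1 ^ (1 / p))).hasSum fun k => hub k z
  · intro y γ
    have h := integral_tsum_eq_sub (Q := P.sectL γ) (u := fun k x => u k (x, γ))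
      (fun k => (hum k).comp (measurable_id.prodMk measurable_const)) hcs
      (fun k x => hub k (x, γ)) y (hWi γ y) (fun k => by
        have hik : Integrable (fun x => ∫ z, ψ z ∂((P.sectL γ ^ k) x)) (P.sectL γ y) := by
          have := integrable_integral_pow (P.sectL γ) k 1 y (hi γ _ y)
          rwa [pow_one] at this
        simp only [u]
        rw [integral_sub hik (integrable_const _), integral_pow_add _ k 1 _ (hi _ _ _), pow_one]
        simp)
    have h0 : u 0 (y, γ) = ψ y - m := by
      simp only [u, pow_zero]
      congr 1
      exact integral_dirac' _ _ hψ.stronglyMeasurable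
    rw [← h0]
    exact h

end Poisson

/-! ### Convergence of L²-bounded martingales -/

section Martingale

variable {Ω : Type*} {mΩ : MeasurableSpace Ω} {μ : Measure Ω}

theorem integral_mul_eq_zero_of_condExp_eq_zero [IsFiniteMeasure μ] {m : MeasurableSpace Ω}
    (hm : m ≤ mΩ) {X D : Ω → ℝ} (hX : StronglyMeasurable[m] X) (hX2 : MemLp X 2 μ)
    (hD2 : MemLp D 2 μ) (hD : μ[D | m] =ᵐ[μ] 0) : ∫ ω, X ω * D ω ∂μ = 0 := by
  have hi : Integrable (X * D) μ := hX2.integrable_mul hD2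
  have h := condExp_mul_of_stronglyMeasurable_left hX hi (hD2.integrable one_le_two)
  have e : ∫ ω, X ω * D ω ∂μ = ∫ ω, (μ[X * D | m]) ω ∂μ := (integral_condExp hm).symm
  rw [e]
  refine integral_eq_zero_of_ae (h.trans ?_)
  filter_upwards [hD] with ω hω
  simp [hω]

/-- A series of weighted martingale differences with bounded second moments and square-summable
weights converges almost surely. -/
theorem exists_tendsto_sum_mul_of_condExp_eq_zero [IsProbabilityMeasure μ] (ℱ : Filtration ℕ mΩ)
    {D : ℕ → Ω → ℝ} (hDm : ∀ n, StronglyMeasurable[ℱ (n + 1)] (D n))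
    (hD2 : ∀ n, MemLp (D n) 2 μ) {C : ℝ} (hC : ∀ n, ∫ ω, D n ω ^ 2 ∂μ ≤ C)
    (hD : ∀ n, μ[D n | ℱ n] =ᵐ[μ] 0) {a : ℕ → ℝ} (ha : Summable fun n => a n ^ 2) :
    ∀ᵐ ω ∂μ, ∃ s, Tendsto (fun n => ∑ k ∈ Finset.range n, a k * D k ω) atTop (𝓝 s) := by
  let M : ℕ → Ω → ℝ := fun n ω => ∑ k ∈ Finset.range n, a k * D k ω
  have hMs : ∀ n ω, M (n + 1) ω = M n ω + a n * D n ω := fun n ω => Finset.sum_range_succ _ _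
  have hMm : ∀ n, StronglyMeasurable[ℱ n] (M n) := fun n =>
    Finset.stronglyMeasurable_fun_sum _ fun k hk =>
      ((hDm k).mono (ℱ.mono (Finset.mem_range.1 hk))).const_mul (a k)
  have hM2 : ∀ n, MemLp (M n) 2 μ := fun n =>
    memLp_finsetSum _ fun k _ => (hD2 k).const_mul (a k)
  have hC0 : 0 ≤ C := (integral_nonneg fun ω => sq_nonneg _).trans (hC 0)
  -- The cross terms vanish by orthogonality of the increments.
  have hbound : ∀ n, ∫ ω, M n ω ^ 2 ∂μ ≤ (∑ k ∈ Finset.range n, a k ^ 2) * C := by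
    intro n
    induction n with
    | zero => simp [M]
    | succ n ih =>
      have h0 := integral_mul_eq_zero_of_condExp_eq_zero (ℱ.le n) (hMm n) (hM2 n) (hD2 n) (hD n)
      have e : ∀ ω, M (n + 1) ω ^ 2 =
          M n ω ^ 2 + (2 * a n * (M n ω * D n ω) + a n ^ 2 * D n ω ^ 2) := fun ω => by
        rw [hMs]; ring
      have i1 : Integrable (fun ω => M n ω * D n ω) μ := (hM2 n).integrable_mul (hD2 n)
      have i2 : Integrable (fun ω => 2 * a n * (M n ω * D n ω)) μ := i1.const_mul _
      have i3 : Integrable (fun ω => a n ^ 2 * D n ω ^ 2) μ := (hD2 n).integrable_sq.const_mul _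
      have i23 : Integrable
          (fun ω => 2 * a n * (M n ω * D n ω) + a n ^ 2 * D n ω ^ 2) μ := i2.add i3
      simp_rw [e]
      rw [integral_add (hM2 n).integrable_sq i23, integral_add i2 i3,
        integral_const_mul, integral_const_mul, h0, Finset.sum_range_succ, add_mul, mul_zero,
        zero_add]
      exact add_le_add ih (mul_le_mul_of_nonneg_left (hC n) (sq_nonneg _))
  have hmart : Martingale M ℱ μ := by
    refine martingale_of_condExp_sub_eq_zero_nat hMm
      (fun n => (hM2 n).integrable one_le_two) fun n => ?_
    have e : M (n + 1) - M n = a n • D n := by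
      funext ω
      simp [hMs]
    rw [e]
    refine (condExp_smul (a n) (D n) (ℱ n)).trans ?_
    filter_upwards [hD n] with ω hω
    simp [hω]
  refine hmart.submartingale.exists_ae_tendsto_of_bdd
    (R := (1 + (∑' k, a k ^ 2) * C).toNNReal) fun n => ?_
  rw [eLpNorm_one_eq_lintegral_enorm,
    ← ofReal_integral_norm_eq_lintegral_enorm ((hM2 n).integrable one_le_two)]
  refine ENNReal.ofReal_le_ofReal ?_
  -- The inequality |x| ≤ 1 + x² turns the L² bound into the L¹ bound needed for martingale
  -- convergence.
  calc ∫ ω, ‖M n ω‖ ∂μ ≤ ∫ ω, (1 + M n ω ^ 2) ∂μ := by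
        refine integral_mono ((hM2 n).integrable one_le_two).norm
          ((integrable_const _).add (hM2 n).integrable_sq) fun ω => ?_
        simp only [Real.norm_eq_abs]
        nlinarith [sq_nonneg (|M n ω| - 1), sq_abs (M n ω), abs_nonneg (M n ω)]
    _ = 1 + ∫ ω, M n ω ^ 2 ∂μ := by
        rw [integral_add (integrable_const _) (hM2 n).integrable_sq]
        simp
    _ ≤ 1 + (∑' k, a k ^ 2) * C := by
        gcongr
        exact (hbound n).trans (mul_le_mul_of_nonneg_right
          (ha.sum_le_tsum _ fun k _ => sq_nonneg _) hC0)

end Martingale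

/-! ### One-step laws and moments of the adaptive chain -/

section History

variable {Ω S I : Type*} [MeasurableSpace S] [MeasurableSpace I] {Y : ℕ → Ω → S} {Γ : ℕ → Ω → I}

theorem measurable_state_history {n j : ℕ} (hj : j ≤ n) : Measurable[history Y Γ n] (Y j) :=
  Measurable.of_comap_le (le_sup_left.trans
    (le_iSup₂ (f := fun j (_ : j ≤ n) => MeasurableSpace.comap (Y j) inferInstance ⊔
      MeasurableSpace.comap (Γ j) inferInstance) j hj))

theorem measurable_param_history {n j : ℕ} (hj : j ≤ n) : Measurable[history Y Γ n] (Γ j) :=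
  Measurable.of_comap_le (le_sup_right.trans
    (le_iSup₂ (f := fun j (_ : j ≤ n) => MeasurableSpace.comap (Y j) inferInstance ⊔
      MeasurableSpace.comap (Γ j) inferInstance) j hj))

theorem measurable_pair_history (n : ℕ) :
    Measurable[history Y Γ n] fun ω => (Y n ω, Γ n ω) :=
  (measurable_state_history le_rfl).prodMk (measurable_param_history le_rfl)

end History

namespace IsAdaptiveChain

variable {Ω S I : Type*} [MeasurableSpace Ω] [MeasurableSpace S] [MeasurableSpace I]
  {μ : Measure Ω} {P : Kernel (S × I) S} {y₀ : S} {γ₀ : I} {Y : ℕ → Ω → S} {Γ : ℕ → Ω → I}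

theorem history_le (h : IsAdaptiveChain μ P y₀ γ₀ Y Γ) (n : ℕ) :
    history Y Γ n ≤ (inferInstance : MeasurableSpace Ω) :=
  iSup₂_le fun j _ => sup_le (h.measurable_state j).comap_le (h.measurable_param j).comap_le

/-- The filtration generated by the chain. -/
def filtration (h : IsAdaptiveChain μ P y₀ γ₀ Y Γ) :
    Filtration ℕ (inferInstance : MeasurableSpace Ω) where
  seq := history Y Γ
  mono' _ _ hmn := iSup₂_le fun j hj => le_iSup₂_of_le j (hj.trans hmn) le_rfl
  le' := h.history_le

theorem measurable_pair (h : IsAdaptiveChain μ P y₀ γ₀ Y Γ) (n : ℕ) :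
    Measurable fun ω => (Y n ω, Γ n ω) :=
  (h.measurable_state n).prodMk (h.measurable_param n)

/-- On any event of the history up to time `n`, the law of the next state given the current
state and parameter is given by `P`. -/
theorem map_restrict [IsProbabilityMeasure μ] [IsMarkovKernel P]
    (h : IsAdaptiveChain μ P y₀ γ₀ Y Γ) (n : ℕ)
    {A : Set Ω} (hA : MeasurableSet[history Y Γ n] A) :
    (μ.restrict A).map (fun ω => ((Y n ω, Γ n ω), Y (n + 1) ω)) =
      ((μ.restrict A).map fun ω => (Y n ω, Γ n ω)) ⊗ₘ P := by
  have hZ := h.measurable_pair n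
  have hY := h.measurable_state (n + 1)
  refine Measure.ext_prod fun {s t} hs ht => ?_
  rw [Measure.compProd_apply_prod hs ht, Measure.map_apply (hZ.prodMk hY) (hs.prod ht),
    setLIntegral_map hs (Kernel.measurable_coe P ht) hZ, Measure.restrict_restrict (hZ hs),
    Measure.restrict_apply ((hZ.prodMk hY) (hs.prod ht))]
  have hm := h.history_le n
  -- On rectangles, the condition on the current pair is absorbed into the history event, leaving
  -- only the defining transition property for t.
  have hE : MeasurableSet[history Y Γ n] ((fun ω => (Y n ω, Γ n ω)) ⁻¹' s ∩ A) :=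
    (measurable_pair_history n hs).inter hA
  set E := (fun ω => (Y n ω, Γ n ω)) ⁻¹' s ∩ A
  have hset : (fun ω => ((Y n ω, Γ n ω), Y (n + 1) ω)) ⁻¹' s ×ˢ t ∩ A =
      (Y (n + 1) ⁻¹' t) ∩ E := by
    ext ω
    simp only [E, Set.mem_inter_iff, Set.mem_preimage, Set.mem_prod]
    tauto
  rw [hset]
  have h1 : ∫ ω in E, (μ⟦Y (n + 1) ⁻¹' t | history Y Γ n⟧) ω ∂μ = μ.real (Y (n + 1) ⁻¹' t ∩ E) := by
    rw [setIntegral_condExp hm ((integrable_const _).indicator (hY ht)) hE,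
      integral_indicator_const _ (hY ht), measureReal_restrict_apply (hY ht)]
    simp
  have h2 : ∫ ω in E, (μ⟦Y (n + 1) ⁻¹' t | history Y Γ n⟧) ω ∂μ =
      ∫ ω in E, (P (Y n ω, Γ n ω)).real t ∂μ :=
    integral_congr_ae (ae_restrict_of_ae (h.transition n t ht))
  have h3 : ENNReal.ofReal (∫ ω in E, (P (Y n ω, Γ n ω)).real t ∂μ) =
      ∫⁻ ω in E, P (Y n ω, Γ n ω) t ∂μ := by
    rw [ofReal_integral_eq_lintegral_ofReal]
    · refine lintegral_congr fun ω => ?_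
      simp
    · refine Integrable.of_bound
        ((Kernel.measurable_coe P ht).comp hZ).ennreal_toReal.aestronglyMeasurable 1
        (Eventually.of_forall fun ω => ?_)
      rw [Real.norm_of_nonneg measureReal_nonneg]
      exact measureReal_le_one
    · exact Eventually.of_forall fun ω => ENNReal.toReal_nonneg
  rw [← h3, ← h2, h1, ofReal_measureReal]

/-- The transition property only concerns events of the next state. Disintegrating the joint law on
every history event extends it to functions of the current pair and the next state. -/
theorem condExp_next [IsProbabilityMeasure μ] [IsMarkovKernel P]
    (h : IsAdaptiveChain μ P y₀ γ₀ Y Γ) (n : ℕ) {G : (S × I) × S → ℝ} (hG : Measurable G)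
    (hi : Integrable (fun ω => G ((Y n ω, Γ n ω), Y (n + 1) ω)) μ) :
    μ[fun ω => G ((Y n ω, Γ n ω), Y (n + 1) ω) | history Y Γ n] =ᵐ[μ]
      fun ω => ∫ y, G ((Y n ω, Γ n ω), y) ∂(P (Y n ω, Γ n ω)) := by
  have hZ := h.measurable_pair n
  have hZY := hZ.prodMk (h.measurable_state (n + 1))
  have hcp : ∀ A, MeasurableSet[history Y Γ n] A →
      Integrable G (((μ.restrict A).map fun ω => (Y n ω, Γ n ω)) ⊗ₘ P) := fun A hA => by
    rw [← h.map_restrict n hA]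
    exact (integrable_map_measure hG.aestronglyMeasurable hZY.aemeasurable).2 hi.restrict
  have hint : StronglyMeasurable fun z : S × I => ∫ y, G (z, y) ∂(P z) :=
    hG.stronglyMeasurable.integral_kernel_prod_right'
  have hI : Integrable (fun ω => ∫ y, G ((Y n ω, Γ n ω), y) ∂(P (Y n ω, Γ n ω))) μ := by
    have h1 := (hcp Set.univ MeasurableSet.univ).integral_compProd
    rw [Measure.restrict_univ] at h1
    exact (integrable_map_measure hint.aestronglyMeasurable hZ.aemeasurable).1 h1
  refine (ae_eq_condExp_of_forall_setIntegral_eq (h.history_le n) hi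
    (fun A _ _ => hI.integrableOn) (fun A hA _ => ?_) ?_).symm
  · have e1 := integral_map (μ := μ.restrict A) hZY.aemeasurable hG.aestronglyMeasurable
    have e2 := integral_map (μ := μ.restrict A) hZ.aemeasurable hint.aestronglyMeasurable
    rw [h.map_restrict n hA, Measure.integral_compProd (hcp A hA)] at e1
    rw [← e1, ← e2]
  · exact (hint.measurable.comp (measurable_pair_history n)).stronglyMeasurable.aestronglyMeasurable

theorem lintegral_next [IsProbabilityMeasure μ] [IsMarkovKernel P]
    (h : IsAdaptiveChain μ P y₀ γ₀ Y Γ) (n : ℕ) {φ : S → ℝ≥0∞} (hφ : Measurable φ) :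
    ∫⁻ ω, φ (Y (n + 1) ω) ∂μ = ∫⁻ ω, ∫⁻ y, φ y ∂(P (Y n ω, Γ n ω)) ∂μ := by
  have hZ := h.measurable_pair n
  have hZY := hZ.prodMk (h.measurable_state (n + 1))
  have hφ2 : Measurable fun w : (S × I) × S => φ w.2 := hφ.comp measurable_snd
  have e := h.map_restrict n MeasurableSet.univ
  rw [Measure.restrict_univ] at e
  have e1 := lintegral_map (μ := μ) hφ2 hZY
  rw [e, Measure.lintegral_compProd hφ2, lintegral_map (hφ2.lintegral_kernel_prod_right') hZ] at e1
  exact e1.symm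

theorem lintegral_lyapunov_le [IsProbabilityMeasure μ] [IsMarkovKernel P]
    (h : IsAdaptiveChain μ P y₀ γ₀ Y Γ) {V : S → ℝ} (hV : IsCommonLyapunov P V) :
    ∃ C : ℝ, 0 ≤ C ∧ ∀ n, ∫⁻ ω, ENNReal.ofReal (V (Y n ω)) ∂μ ≤ ENNReal.ofReal C := by
  obtain ⟨κ, b, hκ, hκ1, hb, hdrift⟩ := hV.drift
  have hV0 : 0 ≤ V y₀ := zero_le_one.trans (hV.one_le y₀)
  have h1κ : 0 < 1 - κ := by linarith
  have hB : 0 < b / (1 - κ) := div_pos hb h1κ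
  -- This constant dominates V y₀ and is not increased by x ↦ κ x + b.
  refine ⟨V y₀ + b / (1 - κ), by positivity, fun n => ?_⟩
  induction n with
  | zero =>
    simp only [h.init_state, lintegral_const, measure_univ, mul_one]
    exact ENNReal.ofReal_le_ofReal (by linarith)
  | succ n ih =>
    rw [h.lintegral_next n hV.measurable.ennreal_ofReal]
    calc ∫⁻ ω, ∫⁻ y, ENNReal.ofReal (V y) ∂(P (Y n ω, Γ n ω)) ∂μ
        ≤ ∫⁻ ω, (ENNReal.ofReal κ * ENNReal.ofReal (V (Y n ω)) + ENNReal.ofReal b) ∂μ := by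
          refine lintegral_mono fun ω => (hdrift (Γ n ω) (Y n ω)).trans ?_
          rw [← ENNReal.ofReal_mul hκ.le]
          exact ENNReal.ofReal_add_le
      _ = ENNReal.ofReal κ * ∫⁻ ω, ENNReal.ofReal (V (Y n ω)) ∂μ + ENNReal.ofReal b := by
          have hVY : Measurable fun ω => ENNReal.ofReal (V (Y n ω)) :=
            (hV.measurable.comp (h.measurable_state n)).ennreal_ofReal
          rw [lintegral_add_right _ measurable_const, lintegral_const_mul _ hVY]
          simp
      _ ≤ ENNReal.ofReal κ * ENNReal.ofReal (V y₀ + b / (1 - κ)) + ENNReal.ofReal b := by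
          gcongr
      _ ≤ ENNReal.ofReal (V y₀ + b / (1 - κ)) := by
          rw [← ENNReal.ofReal_mul hκ.le, ← ENNReal.ofReal_add (by positivity) hb.le]
          refine ENNReal.ofReal_le_ofReal ?_
          have e : κ * (b / (1 - κ)) + b = b / (1 - κ) := by
            field_simp
            ring
          nlinarith

end IsAdaptiveChain

/-! ### Kronecker's lemma and counting adaptation times -/

section Deterministic

/-- **Kronecker's lemma**. -/
theorem tendsto_sum_div_of_tendsto_sum_div {b x : ℕ → ℝ} {s : ℝ} (hb0 : b 0 = 0)
    (hb : Monotone b) (hbpos : ∀ n, 0 < b (n + 1)) (hbt : Tendsto b atTop atTop)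
    (hs : Tendsto (fun n => ∑ k ∈ Finset.range n, x k / b (k + 1)) atTop (𝓝 s)) :
    Tendsto (fun n => (∑ k ∈ Finset.range n, x k) / b n) atTop (𝓝 0) := by
  set S : ℕ → ℝ := fun n => ∑ k ∈ Finset.range n, x k / b (k + 1) with hS
  have hSs : ∀ n, b (n + 1) * (S (n + 1) - S n) = x n := fun n => by
    rw [hS]
    simp only [Finset.sum_range_succ, add_sub_cancel_left]
    field_simp [(hbpos n).ne']
  have hg : ∀ n, ∑ k ∈ Finset.range n, (b (k + 1) - b k) = b n := fun n => by
    rw [Finset.sum_range_sub, hb0, sub_zero]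
  -- Abel summation with centred partial sums. After division by b n, the last sum is a weighted
  -- average of a null sequence; the weights sum to b n because b 0 = 0.
  have habel : ∀ n, ∑ k ∈ Finset.range n, x k =
      b n * (S n - s) - ∑ k ∈ Finset.range n, (b (k + 1) - b k) * (S k - s) := by
    intro n
    induction n with
    | zero => simp [hb0]
    | succ n ih =>
      rw [Finset.sum_range_succ, Finset.sum_range_succ, ih, ← hSs n]
      ring
  have hlo : (fun n => ∑ k ∈ Finset.range n, (b (k + 1) - b k) * (S k - s)) =o[atTop]
      fun n => ∑ k ∈ Finset.range n, (b (k + 1) - b k) := by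
    refine Asymptotics.IsLittleO.sum_range ?_ (fun n => sub_nonneg.2 (hb n.le_succ)) ?_
    · have h1 : (fun k => S k - s) =o[atTop] fun _ => (1 : ℝ) := by
        rw [Asymptotics.isLittleO_one_iff]
        simpa using hs.sub_const s
      simpa using (Asymptotics.isBigO_refl (fun k => b (k + 1) - b k) atTop).mul_isLittleO h1
    · simpa only [hg] using hbt
  simp only [hg] at hlo
  have h2 := hlo.tendsto_div_nhds_zero
  have h3 : Tendsto (fun n => (S n - s) -
      (∑ k ∈ Finset.range n, (b (k + 1) - b k) * (S k - s)) / b n) atTop (𝓝 0) := by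
    simpa using (hs.sub_const s).sub h2
  refine h3.congr' ?_
  filter_upwards [hbt.eventually_gt_atTop 0] with n hn
  rw [habel, sub_div, mul_div_cancel_left₀ _ hn.ne']

theorem adaptTime_zero (β : ℝ) : adaptTime β 0 = 0 := by simp [adaptTime]

theorem strictMono_adaptTime (β : ℝ) : StrictMono (adaptTime β) := by
  refine strictMono_nat_of_lt_succ fun m => ?_
  unfold adaptTime
  rw [Finset.sum_Icc_succ_top (by omega)]
  have : 0 < ⌈((m + 1 : ℕ) : ℝ) ^ β⌉₊ := Nat.ceil_pos.2 (by positivity)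
  omega

/-- Only indices j > m / 2 are kept: there are at least m / 2 of them, each contributing at least (m
/ 2) ^ β. -/
theorem rpow_half_le_adaptTime {β : ℝ} (hβ : 0 < β) (m : ℕ) :
    ((m : ℝ) / 2) ^ (1 + β) ≤ adaptTime β m := by
  rcases Nat.eq_zero_or_pos m with rfl | hm
  · simp [adaptTime, Real.zero_rpow (by linarith : 1 + β ≠ 0)]
  have hm' : (0 : ℝ) < m := by exact_mod_cast hm
  have hsub : Finset.Icc (m / 2 + 1) m ⊆ Finset.Icc 1 m :=
    Finset.Icc_subset_Icc (by omega) le_rfl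
  unfold adaptTime
  push_cast
  calc ((m : ℝ) / 2) ^ (1 + β) = (m : ℝ) / 2 * ((m : ℝ) / 2) ^ β := by
        rw [Real.rpow_add (by positivity), Real.rpow_one]
    _ ≤ ((Finset.Icc (m / 2 + 1) m).card : ℝ) * ((m : ℝ) / 2) ^ β := by
        gcongr
        rw [Nat.card_Icc, div_le_iff₀ two_pos]
        norm_cast
        omega
    _ = ∑ j ∈ Finset.Icc (m / 2 + 1) m, ((m : ℝ) / 2) ^ β := by
        rw [Finset.sum_const, nsmul_eq_mul]
    _ ≤ ∑ j ∈ Finset.Icc (m / 2 + 1) m, (⌈(j : ℝ) ^ β⌉₊ : ℝ) := by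
        refine Finset.sum_le_sum fun j hj => ?_
        refine le_trans ?_ (Nat.le_ceil _)
        refine Real.rpow_le_rpow (by positivity) ?_ hβ.le
        rw [div_le_iff₀ two_pos]
        have := (Finset.mem_Icc.1 hj).1
        norm_cast
        omega
    _ ≤ ∑ j ∈ Finset.Icc 1 m, (⌈(j : ℝ) ^ β⌉₊ : ℝ) :=
        Finset.sum_le_sum_of_subset_of_nonneg hsub fun _ _ _ => by positivity

open Classical in
/-- There are at most of order `n ^ (1 / (1 + β))` adaptation times up to time `n`. -/
theorem card_adaptTime_le {β : ℝ} (hβ : 0 < β) {n : ℕ} (hn : 1 ≤ n) :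
    (((Finset.range n).filter fun k => ∃ m, k + 1 = adaptTime β m).card : ℝ) ≤
      3 * (n : ℝ) ^ (1 / (1 + β)) := by
  have hn1 : (1 : ℝ) ≤ (n : ℝ) ^ (1 / (1 + β)) :=
    Real.one_le_rpow (by exact_mod_cast hn) (by positivity)
  -- Inverting (m / 2) ^ (1 + β) ≤ n gives m ≤ N. Counting m = 0 too gives N + 1 candidates, and the
  -- 1 is absorbed into the factor 3.
  set N := ⌊2 * (n : ℝ) ^ (1 / (1 + β))⌋₊ with hN
  have hsub : ((Finset.range n).filter fun k => ∃ m, k + 1 = adaptTime β m) ⊆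
      (Finset.range (N + 1)).image fun m => adaptTime β m - 1 := by
    intro k hk
    obtain ⟨hkn, m, hm⟩ := Finset.mem_filter.1 hk
    refine Finset.mem_image.2 ⟨m, ?_, by omega⟩
    rw [Finset.mem_range, Nat.lt_succ_iff, hN]
    refine Nat.le_floor ?_
    have h1 : ((m : ℝ) / 2) ^ (1 + β) ≤ n := (rpow_half_le_adaptTime hβ m).trans (by
      rw [← hm]
      exact_mod_cast Finset.mem_range.1 hkn)
    have h2 := Real.rpow_le_rpow (by positivity) h1 (z := 1 / (1 + β)) (by positivity)
    rw [← Real.rpow_mul (by positivity), mul_one_div_cancel (by positivity), Real.rpow_one] at h2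
    linarith
  have hcard := (Finset.card_le_card hsub).trans Finset.card_image_le
  rw [Finset.card_range] at hcard
  have hfl : (N : ℝ) ≤ 2 * (n : ℝ) ^ (1 / (1 + β)) := Nat.floor_le (by positivity)
  have : (((Finset.range n).filter fun k => ∃ m, k + 1 = adaptTime β m).card : ℝ) ≤ N + 1 := by
    exact_mod_cast hcard
  linarith

/-- The parameter does not change outside the adaptation times. -/
theorem IsIncreasinglyRare.eq_of_forall_ne {Ω I : Type*} {β : ℝ} {Γ : ℕ → Ω → I}
    (h : IsIncreasinglyRare β Γ) {k : ℕ} (hk : ¬ ∃ m, k + 1 = adaptTime β m) (ω : Ω) :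
    Γ (k + 1) ω = Γ k ω := by
  have hT := strictMono_adaptTime β
  have hex : ∃ m, k < adaptTime β m := ⟨k + 1, hT.le_apply⟩
  classical
  -- Here m indexes the block containing k; since k + 1 is not an adaptation time, it lies in the
  -- same block.
  obtain ⟨m, hm⟩ : ∃ m, Nat.find hex = m + 1 := by
    refine Nat.exists_eq_succ_of_ne_zero fun h0 => ?_
    have := Nat.find_spec hex
    rw [h0, adaptTime_zero] at this
    omega
  have h1 : k < adaptTime β (m + 1) := hm ▸ Nat.find_spec hex
  have h2 : adaptTime β m ≤ k := not_lt.1 (Nat.find_min hex (by omega))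
  have h3 : k + 1 ≠ adaptTime β (m + 1) := fun e => hk ⟨_, e⟩
  exact h m _ _ ⟨by omega, by omega⟩ ⟨h2, h1⟩ ω

open Classical in
/-- A telescoping sum that jumps only at the adaptation times is of polynomially smaller order. -/
theorem tendsto_sum_sub_div {β : ℝ} (hβ : 0 < β) {G H : ℕ → ℝ} {C q a : ℝ} (hC : 0 ≤ C)
    (hq : 0 ≤ q) (hG : ∀ n, |G n| ≤ C * ((n : ℝ) + 1) ^ q)
    (hH : ∀ n, |H n| ≤ C * ((n : ℝ) + 2) ^ q)
    (hGH : ∀ k, (¬ ∃ m, k + 1 = adaptTime β m) → G (k + 1) = H k)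
    (ha : 1 / (1 + β) + q < a) :
    Tendsto (fun n : ℕ => (∑ k ∈ Finset.range n, (G (k + 1) - H (k + 1))) / (n : ℝ) ^ a)
      atTop (𝓝 0) := by
  set r := 1 / (1 + β) with hr
  have hr0 : 0 < r := by positivity
  -- Shifting H by one index makes the summand vanish off the adaptation times, at the price of two
  -- boundary terms.
  have htel : ∀ n, ∑ k ∈ Finset.range n, (G (k + 1) - H (k + 1)) =
      (∑ k ∈ Finset.range n, (G (k + 1) - H k)) + (H 0 - H n) := by
    intro n
    induction n with
    | zero => simp
    | succ n ih => rw [Finset.sum_range_succ, Finset.sum_range_succ, ih]; ring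
  have hbound : ∀ n : ℕ, 1 ≤ n →
      |∑ k ∈ Finset.range n, (G (k + 1) - H (k + 1))| ≤ 8 * C * 3 ^ q * (n : ℝ) ^ (r + q) := by
    intro n hn
    have hn1 : (1 : ℝ) ≤ n := by exact_mod_cast hn
    have hB : ∀ k : ℕ, k ≤ n → C * ((k : ℝ) + 2) ^ q ≤ C * (3 ^ q * (n : ℝ) ^ q) := by
      intro k hk
      have hk' : (k : ℝ) ≤ n := by exact_mod_cast hk
      rw [← Real.mul_rpow (by norm_num) (by positivity)]
      gcongr
      linarith
    have hjump : |∑ k ∈ Finset.range n, (G (k + 1) - H k)| ≤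
        3 * (n : ℝ) ^ r * (2 * (C * (3 ^ q * (n : ℝ) ^ q))) := by
      rw [← Finset.sum_filter_of_ne (p := fun k => ∃ m, k + 1 = adaptTime β m)
        fun k _ hne => by_contra fun hk => hne (sub_eq_zero.2 (hGH k hk))]
      refine (Finset.abs_sum_le_sum_abs _ _).trans ?_
      refine (Finset.sum_le_card_nsmul _ _ (2 * (C * (3 ^ q * (n : ℝ) ^ q)))
        fun k hk => ?_).trans ?_
      · have hkn := (Finset.mem_range.1 (Finset.mem_filter.1 hk).1).le
        have hGk := hG (k + 1)
        push_cast at hGk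
        rw [add_assoc, one_add_one_eq_two] at hGk
        linarith [abs_sub (G (k + 1)) (H k), hH k, hB k hkn]
      · rw [nsmul_eq_mul]
        exact mul_le_mul_of_nonneg_right (card_adaptTime_le hβ hn) (by positivity)
    have h0 := (hH 0).trans (hB 0 (Nat.zero_le n))
    have hn' := (hH n).trans (hB n le_rfl)
    have hone : (n : ℝ) ^ q ≤ (n : ℝ) ^ (r + q) :=
      Real.rpow_le_rpow_of_exponent_le hn1 (by linarith)
    have hmul : (n : ℝ) ^ r * (n : ℝ) ^ q = (n : ℝ) ^ (r + q) :=
      (Real.rpow_add (by positivity) _ _).symm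
    have hD : 0 ≤ C * 3 ^ q := by positivity
    rw [htel]
    calc _ ≤ |∑ k ∈ Finset.range n, (G (k + 1) - H k)| + (|H 0| + |H n|) :=
          (abs_add_le _ _).trans (add_le_add le_rfl (abs_sub _ _))
      _ ≤ 3 * (n : ℝ) ^ r * (2 * (C * (3 ^ q * (n : ℝ) ^ q))) +
          (C * (3 ^ q * (n : ℝ) ^ q) + C * (3 ^ q * (n : ℝ) ^ q)) :=
          add_le_add hjump (add_le_add h0 hn')
      _ = 6 * (C * 3 ^ q) * ((n : ℝ) ^ r * (n : ℝ) ^ q) + 2 * (C * 3 ^ q) * (n : ℝ) ^ q := by ring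
      _ ≤ 6 * (C * 3 ^ q) * (n : ℝ) ^ (r + q) + 2 * (C * 3 ^ q) * (n : ℝ) ^ (r + q) := by
          rw [hmul]
          gcongr
      _ = 8 * C * 3 ^ q * (n : ℝ) ^ (r + q) := by ring
  have hlim : Tendsto (fun n : ℕ => 8 * C * 3 ^ q * (n : ℝ) ^ (-(a - (r + q)))) atTop (𝓝 0) := by
    simpa using ((tendsto_rpow_neg_atTop (sub_pos.2 ha)).comp
      tendsto_natCast_atTop_atTop).const_mul (8 * C * 3 ^ q)
  refine squeeze_zero_norm' ?_ hlim
  filter_upwards [eventually_ge_atTop 1] with n hn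
  have hn0 : (0 : ℝ) < n := by exact_mod_cast hn
  rw [Real.norm_eq_abs, abs_div, abs_of_pos (Real.rpow_pos_of_pos hn0 a),
    div_le_iff₀ (Real.rpow_pos_of_pos hn0 a), mul_assoc, ← Real.rpow_add hn0]
  refine (hbound n hn).trans_eq ?_
  congr 2
  ring

end Deterministic

/-! ### Almost sure polynomial growth -/

section Growth

theorem summable_one_div_add_one_rpow {s : ℝ} (hs : 1 < s) :
    Summable fun n : ℕ => 1 / ((n : ℝ) + 1) ^ s := by
  have h := (summable_nat_add_iff 1).2 (Real.summable_one_div_nat_rpow.2 hs)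
  simpa using h

/-- Nonnegative random variables with uniformly bounded means are `O(n ^ s)` for every `s > 1`. -/
theorem ae_exists_le_mul_rpow {Ω : Type*} [MeasurableSpace Ω] {μ : Measure Ω} {Z : ℕ → Ω → ℝ}
    (hZ : ∀ n, Measurable (Z n)) {C : ℝ}
    (hC : ∀ n, ∫⁻ ω, ENNReal.ofReal (Z n ω) ∂μ ≤ ENNReal.ofReal C) {s : ℝ} (hs : 1 < s) :
    ∀ᵐ ω ∂μ, ∃ R : ℝ, 0 ≤ R ∧ ∀ n : ℕ, Z n ω ≤ R * ((n : ℝ) + 1) ^ s := by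
  -- With these summable weights, ∑ w n * Z n (positive parts) has finite mean, hence is almost
  -- surely finite; its value serves as R, since it dominates each term.
  let w : ℕ → ℝ := fun n => 1 / ((n : ℝ) + 1) ^ s
  have hw : ∀ n, 0 < w n := fun n => by positivity
  have hm : ∀ n, Measurable fun ω => ENNReal.ofReal (w n) * ENNReal.ofReal (Z n ω) :=
    fun n => (hZ n).ennreal_ofReal.const_mul _
  have hfin : ∫⁻ ω, ∑' n, ENNReal.ofReal (w n) * ENNReal.ofReal (Z n ω) ∂μ ≠ ∞ := by
    rw [lintegral_tsum fun n => (hm n).aemeasurable]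
    refine ne_top_of_le_ne_top ?_ (ENNReal.tsum_le_tsum (g := fun n =>
      ENNReal.ofReal (w n) * ENNReal.ofReal C) fun n => ?_)
    · rw [ENNReal.tsum_mul_right]
      refine ENNReal.mul_ne_top ?_ ENNReal.ofReal_ne_top
      exact (summable_one_div_add_one_rpow hs).tsum_ofReal_ne_top
    · rw [lintegral_const_mul _ (hZ n).ennreal_ofReal]
      exact mul_le_mul_right (hC n) _
  filter_upwards [ae_lt_top (Measurable.tsum hm) hfin] with ω hω
  refine ⟨(∑' n, ENNReal.ofReal (w n) * ENNReal.ofReal (Z n ω)).toReal, ENNReal.toReal_nonneg,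
    fun n => ?_⟩
  have h1 := ENNReal.le_tsum (f := fun n => ENNReal.ofReal (w n) * ENNReal.ofReal (Z n ω)) n
  rw [← ENNReal.ofReal_mul (hw n).le] at h1
  have h2 := (ENNReal.ofReal_le_iff_le_toReal hω.ne).1 h1
  simp only [w] at h2
  rwa [one_div_mul_eq_div, div_le_iff₀ (by positivity)] at h2

end Growth

/-! ### Strong law for the martingale part -/

namespace IsAdaptiveChain

variable {Ω S I : Type*} [MeasurableSpace Ω] [MeasurableSpace S] [MeasurableSpace I]
  {μ : Measure Ω} [IsProbabilityMeasure μ] {P : Kernel (S × I) S} [IsMarkovKernel P] {y₀ : S}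
  {γ₀ : I} {Y : ℕ → Ω → S} {Γ : ℕ → Ω → I}

/-- The martingale part of the Poisson decomposition satisfies a strong law at every rate
`n ^ a` with `a > 1 / 2`. -/
theorem tendsto_sum_poisson_martingale (h : IsAdaptiveChain μ P y₀ γ₀ Y Γ) {V : S → ℝ}
    (hV : IsCommonLyapunov P V) {p : ℝ} (hp : 2 ≤ p) {ψ : S → ℝ} (hψ : Measurable ψ)
    (hψV : ∀ y, |ψ y| ≤ V y ^ (1 / p)) {m : ℝ} {g : S × I → ℝ} {C : ℝ} (hg : Measurable g)
    (hC : 0 ≤ C) (hgV : ∀ z, |g z| ≤ C * V z.1 ^ (1 / p))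
    (hpoisson : ∀ y γ, ∫ x, g (x, γ) ∂(P (y, γ)) = g (y, γ) - (ψ y - m)) {a : ℝ}
    (ha : 1 / 2 < a) :
    ∀ᵐ ω ∂μ, Tendsto (fun n : ℕ => (∑ k ∈ Finset.range n,
      (g (Y (k + 2) ω, Γ (k + 1) ω) - (g (Y (k + 1) ω, Γ (k + 1) ω) - (ψ (Y (k + 1) ω) - m)))) /
        (n : ℝ) ^ a) atTop (𝓝 0) := by
  obtain ⟨κ, b, hκ, hκ1, hb, hdrift⟩ := hV.drift
  obtain ⟨E, hE0, hE⟩ := h.lintegral_lyapunov_le hV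
  have hV0 : ∀ y, 0 ≤ V y := fun y => zero_le_one.trans (hV.one_le y)
  have hp0 : 0 < p := by linarith
  have hW1 : ∀ y, 1 ≤ V y ^ (1 / p) := fun y => Real.one_le_rpow (hV.one_le y) (by positivity)
  have hWsq : ∀ y, (V y ^ (1 / p)) ^ 2 ≤ V y := fun y => by
    rw [← Real.rpow_natCast, ← Real.rpow_mul (hV0 y)]
    conv_rhs => rw [← Real.rpow_one (V y)]
    refine Real.rpow_le_rpow_of_exponent_le (hV.one_le y) ?_
    rw [one_div_mul_eq_div, div_le_one hp0]
    exact_mod_cast hp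
  have hWV : ∀ y, V y ^ (1 / p) ≤ V y := fun y => by
    nlinarith [hW1 y, hWsq y]
  let c : ℝ := C + 1 + |m|
  have hc : 0 ≤ c := by positivity
  -- The next value of g minus its conditional mean, the latter rewritten by the Poisson equation.
  let G : (S × I) × S → ℝ := fun w => g (w.2, w.1.2) - (g w.1 - (ψ w.1.1 - m))
  have hGm : Measurable G :=
    (hg.comp (measurable_snd.prodMk (measurable_snd.comp measurable_fst))).sub
      ((hg.comp measurable_fst).sub
        ((hψ.comp (measurable_fst.comp measurable_fst)).sub_const m))
  have hGsq : ∀ w, G w ^ 2 ≤ 2 * c ^ 2 * (V w.2 + V w.1.1) := by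
    rintro ⟨⟨y, γ⟩, y'⟩
    have h1 := hgV (y', γ)
    have h2 := hgV (y, γ)
    have h3 := hψV y
    have h4 := hW1 y
    have h5 := hW1 y'
    have habs : |G ((y, γ), y')| ≤ c * (V y' ^ (1 / p) + V y ^ (1 / p)) := by
      simp only [G]
      have e1 := abs_sub (g (y', γ)) (g (y, γ) - (ψ y - m))
      have e2 := abs_sub (g (y, γ)) (ψ y - m)
      have e3 := abs_sub (ψ y) m
      have e4 : |m| ≤ |m| * V y ^ (1 / p) := le_mul_of_one_le_right (abs_nonneg m) h4
      have e5 : 0 ≤ (1 + |m|) * V y' ^ (1 / p) := by positivity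
      simp only [c]
      nlinarith
    have h6 : G ((y, γ), y') ^ 2 ≤ (c * (V y' ^ (1 / p) + V y ^ (1 / p))) ^ 2 := by
      rw [← sq_abs]
      gcongr
    refine h6.trans ?_
    rw [mul_pow, mul_comm 2, mul_assoc]
    refine mul_le_mul_of_nonneg_left ?_ (sq_nonneg c)
    have h7 := hWsq y
    have h8 := hWsq y'
    dsimp only
    nlinarith [sq_nonneg (V y' ^ (1 / p) - V y ^ (1 / p))]
  let D : ℕ → Ω → ℝ := fun n ω => G ((Y n ω, Γ n ω), Y (n + 1) ω)
  have hDm : ∀ n, Measurable[history Y Γ (n + 1)] (D n) := fun n =>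
    hGm.comp (((measurable_state_history n.le_succ).prodMk
      (measurable_param_history n.le_succ)).prodMk (measurable_state_history le_rfl))
  have hDm' : ∀ n, Measurable (D n) := fun n => (hDm n).mono (h.history_le _) le_rfl
  have hVi : ∀ n, Integrable (fun ω => V (Y n ω)) μ := fun n =>
    integrable_of_abs_le_of_lintegral_le (V := fun ω => V (Y n ω))
      (hV.measurable.comp (h.measurable_state n)) (fun ω => (abs_of_nonneg (hV0 _)).le) (hE n)
  have hVE : ∀ n, ∫ ω, V (Y n ω) ∂μ ≤ E := fun n => by
    rw [← ENNReal.ofReal_le_ofReal_iff hE0,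
      ofReal_integral_eq_lintegral_ofReal (hVi n) (Eventually.of_forall fun ω => hV0 _)]
    exact hE n
  have hbd : ∀ n, Integrable (fun ω => 2 * c ^ 2 * (V (Y (n + 1) ω) + V (Y n ω))) μ := fun n =>
    ((hVi (n + 1)).add (hVi n)).const_mul _
  have hDsq : ∀ n, Integrable (fun ω => D n ω ^ 2) μ := fun n =>
    (hbd n).mono' ((hDm' n).pow_const 2).aestronglyMeasurable (Eventually.of_forall fun ω => by
      rw [Real.norm_of_nonneg (sq_nonneg _)]
      exact hGsq _)
  have hD2 : ∀ n, MemLp (D n) 2 μ := fun n =>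
    (memLp_two_iff_integrable_sq (hDm' n).aestronglyMeasurable).2 (hDsq n)
  have hDC : ∀ n, ∫ ω, D n ω ^ 2 ∂μ ≤ 2 * c ^ 2 * (E + E) := fun n => by
    refine (integral_mono (hDsq n) (hbd n) fun ω => hGsq _).trans ?_
    rw [integral_const_mul, integral_add (hVi _) (hVi _)]
    exact mul_le_mul_of_nonneg_left (add_le_add (hVE _) (hVE _)) (by positivity)
  have hDcond : ∀ n, μ[D n | history Y Γ n] =ᵐ[μ] 0 := fun n => by
    refine (h.condExp_next n hGm ((hD2 n).integrable one_le_two)).trans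
      (Eventually.of_forall fun ω => ?_)
    have hi : Integrable (fun y => g (y, Γ n ω)) (P (Y n ω, Γ n ω)) := by
      have hWi : Integrable (fun y => V y ^ (1 / p)) (P (Y n ω, Γ n ω)) :=
        integrable_of_abs_le_of_lintegral_le (hV.measurable.pow_const _) (fun y => by
          rw [abs_of_nonneg (zero_le_one.trans (hW1 y))]
          exact hWV y) (hdrift (Γ n ω) (Y n ω))
      exact (hWi.const_mul C).mono'
        (hg.comp (measurable_id.prodMk measurable_const)).aestronglyMeasurable
        (Eventually.of_forall fun y => hgV _)
    simp only [G, Pi.zero_apply]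
    rw [integral_sub hi (integrable_const _), hpoisson]
    simp
  -- The filtration is shifted by one because the ergodic sum starts at time 1.
  let ℱ : Filtration ℕ (inferInstance : MeasurableSpace Ω) :=
    { seq := fun n => history Y Γ (n + 1)
      mono' := fun _ _ hmn => h.filtration.mono (Nat.succ_le_succ hmn)
      le' := fun n => h.history_le (n + 1) }
  have hconv := exists_tendsto_sum_mul_of_condExp_eq_zero (μ := μ) ℱ (D := fun n => D (n + 1))
    (fun n => (hDm (n + 1)).stronglyMeasurable) (fun n => hD2 (n + 1)) (fun n => hDC (n + 1))
    (fun n => hDcond (n + 1)) (a := fun n : ℕ => 1 / ((n : ℝ) + 1) ^ a) (by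
      refine (summable_one_div_add_one_rpow (s := a * 2) (by linarith)).congr fun n => ?_
      rw [div_pow, one_pow, ← Real.rpow_natCast, ← Real.rpow_mul (by positivity)]
      norm_num)
  filter_upwards [hconv] with ω hω
  obtain ⟨s, hs⟩ := hω
  have ha0 : 0 < a := by linarith
  refine tendsto_sum_div_of_tendsto_sum_div (b := fun n : ℕ => (n : ℝ) ^ a)
    (x := fun k => D (k + 1) ω) (s := s) ?_ ?_ ?_ ?_ ?_
  · simp [Real.zero_rpow ha0.ne']
  · exact fun i j hij => Real.rpow_le_rpow (by positivity) (by exact_mod_cast hij) ha0.le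
  · exact fun n => by positivity
  · exact (tendsto_rpow_atTop ha0).comp tendsto_natCast_atTop_atTop
  · refine hs.congr fun n => Finset.sum_congr rfl fun k _ => ?_
    rw [Nat.cast_succ, one_div_mul_eq_div]

end IsAdaptiveChain

end AIRMCMC

end

/-! ### The strong law for AIR chains -/

theorem mainTheorem2
    {X Φ I Ω : Type*}
    [MeasurableSpace X] [StandardBorelSpace X]
    [MeasurableSpace Φ] [StandardBorelSpace Φ]
    [TopologicalSpace (X × Φ)] [PolishSpace (X × Φ)] [BorelSpace (X × Φ)]
    [MeasurableSpace I]
    [MeasurableSpace Ω] (μ : Measure Ω) [IsProbabilityMeasure μ]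
    (ν : Measure X) [IsProbabilityMeasure ν]
    (P : Kernel ((X × Φ) × I) (X × Φ)) [IsMarkovKernel P]
    (π : I → Measure (X × Φ))
    (hπ : AIRMCMC.IsInvariantFamily P π)
    (hν : ∀ γ, (π γ).fst = ν)
    (d : X × Φ → X × Φ → ℝ≥0) (hd : AIRMCMC.IsDistanceLike d)
    (hcontr : AIRMCMC.UniformContraction d P)
    (V : X × Φ → ℝ) (hV : AIRMCMC.IsCommonLyapunov P V)
    (p : ℝ) (hp : 2 < p) (K : ℝ) (hK : 0 < K)
    (hdV : ∀ y₁ y₂, (d y₁ y₂ : ℝ) ≤ K * (V y₁ ^ (1 / p) + V y₂ ^ (1 / p)))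
    (f : X → ℝ) (hf : Measurable f) (hfint : Integrable f ν)
    (L : ℝ) (hL : 0 < L)
    (hLip : AIRMCMC.IsLipschitzWrt d L (fun y : X × Φ => f y.1))
    (hfV : ∀ y : X × Φ, |f y.1| ≤ V y ^ (1 / p))
    (β : ℝ) (hβ : 0 < β)
    (ε : ℝ) (hε : max 0 (1 / (1 + β) + 1 / p - 1 / 2) < ε)
    (y₀ : X × Φ) (γ₀ : I)
    (Y : ℕ → Ω → X × Φ) (Γ : ℕ → Ω → I)
    (hchain : AIRMCMC.IsAdaptiveChain μ P y₀ γ₀ Y Γ)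
    (hair : AIRMCMC.IsIncreasinglyRare β Γ) :
    ∀ᵐ ω ∂μ, Tendsto
      (fun n : ℕ => 1 / (n : ℝ) ^ (1 / 2 + ε) *
        ∑ j ∈ Finset.Icc 1 n, (f (Y j ω).1 - ∫ x, f x ∂ν))
      atTop (𝓝 0) := by
  set a := 1 / 2 + ε with ha_def
  have hε0 : 0 < ε := (le_max_left _ _).trans_lt hε
  have hε1 : 1 / (1 + β) + 1 / p - 1 / 2 < ε := (le_max_right _ _).trans_lt hε
  have hp0 : 0 < p := by linarith
  have hψ : Measurable fun y : X × Φ => f y.1 := hf.comp measurable_fst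
  have hmean : ∀ γ, ∫ y, f y.1 ∂(π γ) = ∫ x, f x ∂ν := fun γ => by
    rw [← hν γ]
    exact (integral_map measurable_fst.aemeasurable hf.aestronglyMeasurable).symm
  obtain ⟨g, C, hg, hC, hgV, hpoisson⟩ := AIRMCMC.exists_poisson_solution hπ hd hcontr hV
    (by linarith) hK hdV hψ hL hLip hfV hmean
  have hmart := hchain.tendsto_sum_poisson_martingale hV hp.le hψ hfV hg hC hgV hpoisson
    (a := a) (by linarith)
  obtain ⟨E, -, hE⟩ := hchain.lintegral_lyapunov_le hV
  -- The lower bound on ε leaves room for q: q > 1 / p gives q * p > 1, as the growth bound on V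
  -- needs, and 1 / (1 + β) + q < a makes the jumps negligible.
  obtain ⟨q, hpq, hqa⟩ : ∃ q, 1 / p < q ∧ q < a - 1 / (1 + β) :=
    exists_between (by linarith)
  have hq0 : 0 < q := lt_trans (by positivity) hpq
  have hgrow := AIRMCMC.ae_exists_le_mul_rpow (μ := μ) (Z := fun n ω => V (Y n ω))
    (fun n => hV.measurable.comp (hchain.measurable_state n)) hE (s := q * p)
    (by rwa [← div_lt_iff₀ hp0])
  filter_upwards [hmart, hgrow] with ω hω hRω
  obtain ⟨R, hR, hVR⟩ := hRω
  have hW : ∀ n, V (Y n ω) ^ (1 / p) ≤ R ^ (1 / p) * ((n : ℝ) + 1) ^ q := fun n => by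
    have h := Real.rpow_le_rpow (zero_le_one.trans (hV.one_le _)) (hVR n)
      (z := 1 / p) (by positivity)
    rwa [Real.mul_rpow hR (by positivity), ← Real.rpow_mul (by positivity), mul_assoc,
      mul_one_div_cancel hp0.ne', mul_one] at h
  have hgR : ∀ n γ, |g (Y n ω, γ)| ≤ C * R ^ (1 / p) * ((n : ℝ) + 1) ^ q := fun n γ => by
    rw [mul_assoc]
    exact (hgV _).trans (mul_le_mul_of_nonneg_left (hW n) hC)
  -- G and H evaluate g at consecutive states with the same parameter; G (k + 1) and H k share the
  -- state and differ only if Γ changes at time k + 1.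
  have hrem := AIRMCMC.tendsto_sum_sub_div hβ (G := fun n => g (Y n ω, Γ n ω))
    (H := fun n => g (Y (n + 1) ω, Γ n ω)) (C := C * R ^ (1 / p)) (q := q) (a := a)
    (by positivity) hq0.le (fun n => hgR n _) (fun n => by
      have h := hgR (n + 1) (Γ n ω)
      rwa [Nat.cast_succ, add_assoc, one_add_one_eq_two] at h)
    (fun k hk => by simp only [hair.eq_of_forall_ne hk ω]) (by linarith)
  have hsum := hω.add hrem
  rw [add_zero] at hsum
  refine hsum.congr fun n => ?_
  rw [← add_div, ← Finset.sum_add_distrib, one_div_mul_eq_div, Finset.range_eq_Ico,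
    ← Finset.Ico_add_one_right_eq_Icc, ← Finset.sum_Ico_add' _ 0 n 1]
  congr 1
  refine Finset.sum_congr rfl fun k _ => ?_
  ring
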